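/- Notation: for complex $a, q$ put $(a;q)_n=\prod_{k=0}^{n-1}(1-aq^k)$, and, for $|q|<1$, $(a;q)_\infty=\prod_{k=0}^{\infty}(1-aq^k)$ and $(a_1,a_2;q)_\infty=(a_1;q)_\infty(a_2;q)_\infty$. For integers $N,M$ let $$\begin{bmatrix}N\\M\end{bmatrix}_{q}=\frac{(q;q)_N}{(q;q)_M(q;q)_{N-M}}\ \text{ if } 0\le M\le N,\qquad \begin{bmatrix}N\\M\end{bmatrix}_{q}=0\ \text{ otherwise}.$$ Corollary 2.6. Let $q$ be a complex number with $|q|<1$ and let $m\ge 0$ be an integer. Then the series below converges and $$\sum_{n=0}^{\infty}\frac{q^{n^2+2mn}}{(q^4;q^4)_n}=(-1)^{m-1}\left[\frac{a_m(q)}{(q^2,q^3;q^5)_\infty(-q^2;q^2)_\infty}-\frac{b_m(q)}{(q,q^4;q^5)_\infty(-q^2;q^2)_\infty}\right],$$ where $a_0(q)=0$, $b_0(q)=1$, and for $m\ge 1$ $$a_m(q)=\sum_{n,j\ge 0}q^{n^2}(-1)^j\begin{bmatrix}m-1-j\\n\end{bmatrix}_{q^2}\begin{bmatrix}n+j\\j\end{bmatrix}_{q^2},\qquad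 b_m(q)=\sum_{n,j\ge 0}q^{n^2+2n}(-1)^j\begin{bmatrix}m-2-j\\n\end{bmatrix}_{q^2}\begin{bmatrix}n+j\\j\end{bmatrix}_{q^2}$$ (both sums have only finitely many nonzero terms). -/

import Mathlib

namespace RogersSlater

/-- The finite `q`-shifted factorial `(a; q)_n = ∏_{k=0}^{n-1} (1 - a q^k)`. -/
noncomputable def qPoch (a q : ℂ) (n : ℕ) : ℂ :=
  ∏ k ∈ Finset.range n, (1 - a * q ^ k)

/-- The infinite `q`-shifted factorial `(a; q)_∞ = ∏_{k ≥ 0} (1 - a q^k)`. -/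
noncomputable def qPochInf (a q : ℂ) : ℂ :=
  ∏' k : ℕ, (1 - a * q ^ k)

/-- For `|q| < 1` the product defining `(a; q)_∞` converges. -/
theorem multipliable_qPochInf (a : ℂ) {q : ℂ} (hq : ‖q‖ < 1) :
    Multipliable fun k : ℕ => (1 - a * q ^ k) := by
  have h : Summable fun k : ℕ => ‖-(a * q ^ k)‖ := by
    simp only [norm_neg, norm_mul, norm_pow]
    exact (summable_geometric_of_lt_one (norm_nonneg q) hq).mul_left ‖a‖
  simpa only [sub_eq_add_neg] using multipliable_one_add_of_summable h

/-- The Gaussian polynomial `[N, M]_q`, with integer arguments, equal to `0` unless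
`0 ≤ M ≤ N`. -/
noncomputable def gaussian (q : ℂ) (N M : ℤ) : ℂ :=
  if 0 ≤ M ∧ M ≤ N then
    qPoch q q N.toNat / (qPoch q q M.toNat * qPoch q q (N - M).toNat)
  else 0

/-- The summand of `aPoly`. -/
noncomputable def aTerm (m : ℕ) (q : ℂ) (p : ℕ × ℕ) : ℂ :=
  q ^ (p.1 ^ 2) * (-1) ^ p.2 * gaussian (q ^ 2) ((m : ℤ) - 1 - p.2) p.1 *
    gaussian (q ^ 2) ((p.1 : ℤ) + p.2) p.2

/-- The summand of `bPoly`. -/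
noncomputable def bTerm (m : ℕ) (q : ℂ) (p : ℕ × ℕ) : ℂ :=
  q ^ (p.1 ^ 2 + 2 * p.1) * (-1) ^ p.2 * gaussian (q ^ 2) ((m : ℤ) - 2 - p.2) p.1 *
    gaussian (q ^ 2) ((p.1 : ℤ) + p.2) p.2

/-- Only finitely many `(n, j)` contribute to the sum over all `n, j ≥ 0` in `aPoly`. -/
theorem support_aTerm_subset (m : ℕ) (q : ℂ) :
    Function.support (aTerm m q) ⊆ ↑(Finset.range m ×ˢ Finset.range m) := by
  intro p hp
  by_contra h
  refine hp ?_
  have h' : ¬ (0 ≤ (p.1 : ℤ) ∧ (p.1 : ℤ) ≤ (m : ℤ) - 1 - p.2) := by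
    simp only [Finset.coe_product, Set.mem_prod, Finset.coe_range, Set.mem_Iio] at h
    omega
  simp only [aTerm, gaussian, if_neg h', mul_zero, zero_mul]

/-- Only finitely many `(n, j)` contribute to the sum over all `n, j ≥ 0` in `bPoly`. -/
theorem support_bTerm_subset (m : ℕ) (q : ℂ) :
    Function.support (bTerm m q) ⊆ ↑(Finset.range m ×ˢ Finset.range m) := by
  intro p hp
  by_contra h
  refine hp ?_
  have h' : ¬ (0 ≤ (p.1 : ℤ) ∧ (p.1 : ℤ) ≤ (m : ℤ) - 2 - p.2) := by
    simp only [Finset.coe_product, Set.mem_prod, Finset.coe_range, Set.mem_Iio] at h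
    omega
  simp only [bTerm, gaussian, if_neg h', mul_zero, zero_mul]

/-- `a_0(q) = 0`, and `a_m(q) = ∑_{n, j ≥ 0} q^{n²} (-1)^j [m-1-j, n]_{q²} [n+j, j]_{q²}` for
`m ≥ 1`. -/
noncomputable def aPoly (m : ℕ) (q : ℂ) : ℂ :=
  if m = 0 then 0 else ∑ᶠ p : ℕ × ℕ, aTerm m q p

/-- `b_0(q) = 1`, and `b_m(q) = ∑_{n, j ≥ 0} q^{n²+2n} (-1)^j [m-2-j, n]_{q²} [n+j, j]_{q²}` for
`m ≥ 1`. -/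
noncomputable def bPoly (m : ℕ) (q : ℂ) : ℂ :=
  if m = 0 then 1 else ∑ᶠ p : ℕ × ℕ, bTerm m q p

end RogersSlater

/-! ### Gaussian polynomials and the recurrence for a_m, b_m -/

namespace RogersSlater

open PowerSeries

/-! Let S_m be the series. Since (1 - q^{4n})/(q⁴;q⁴)_n = 1/(q⁴;q⁴)_{n-1} for n ≥ 1, S_m - S_{m+2} =
q^{2m+1} S_{m+1}; so (-1)^m S_m satisfies u_{m+2} = u_m + q^{2m+1} u_{m+1}. Generating functions of
Gaussian polynomials show that a_m and b_m satisfy it too, with initial values (0, 1) and (1, 0).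
Hence S_m = (-1)^m (b_m S_0 - a_m S_1) (`slaterSum_eq`), and only S_0 and S_1 remain.

For c = 0, 1, expanding (-q²;q²)_∞/(q⁴;q⁴)_n = (-q^{2n+2};q²)_∞/(q²;q²)_n by the q-binomial theorem
and summing along n + k = s turns (-q²;q²)_∞ S_c into Σ q^{s²+cs}/(q;q)_s
(`sum_antidiagonal_slater`, `qPochInf_mul_tsum_slater`). These are the Rogers-Ramanujan series,
evaluated by two applications of Bailey's lemma to the unit Bailey pair, a passage to the limit, and
the Jacobi triple product in base q⁵. -/

theorem qPoch_zero (a q : ℂ) : qPoch a q 0 = 1 := by simp [qPoch]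

theorem qPoch_succ (a q : ℂ) (n : ℕ) : qPoch a q (n + 1) = qPoch a q n * (1 - a * q ^ n) := by
  simp [qPoch, Finset.prod_range_succ]

theorem one_sub_mul_pow_ne_zero {a q : ℂ} (ha : ‖a‖ < 1) (hq : ‖q‖ < 1) (n : ℕ) :
    1 - a * q ^ n ≠ 0 := by
  intro h
  have h1 : ‖a * q ^ n‖ = 1 := by rw [← sub_eq_zero.mp h, norm_one]
  have h2 : ‖a * q ^ n‖ ≤ ‖a‖ := by
    rw [norm_mul, norm_pow]
    exact mul_le_of_le_one_right (norm_nonneg a) (pow_le_one₀ (norm_nonneg q) hq.le)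
  linarith

theorem qPoch_ne_zero {a q : ℂ} (ha : ‖a‖ < 1) (hq : ‖q‖ < 1) (n : ℕ) : qPoch a q n ≠ 0 :=
  Finset.prod_ne_zero_iff.mpr fun k _ => one_sub_mul_pow_ne_zero ha hq k

theorem qPochInf_ne_zero {a q : ℂ} (ha : ‖a‖ < 1) (hq : ‖q‖ < 1) : qPochInf a q ≠ 0 := by
  have h : Summable fun k : ℕ => ‖-(a * q ^ k)‖ := by
    simp only [norm_neg, norm_mul, norm_pow]
    exact (summable_geometric_of_lt_one (norm_nonneg q) hq).mul_left ‖a‖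
  have := tprod_one_add_ne_zero_of_summable (f := fun k : ℕ => -(a * q ^ k))
    (fun k => by simpa only [sub_eq_add_neg] using one_sub_mul_pow_ne_zero ha hq k) h
  simpa only [qPochInf, sub_eq_add_neg] using this

theorem tendsto_qPoch (a : ℂ) {q : ℂ} (hq : ‖q‖ < 1) :
    Filter.Tendsto (qPoch a q) Filter.atTop (nhds (qPochInf a q)) :=
  (multipliable_qPochInf a hq).tendsto_prod_tprod_nat

theorem norm_pow_lt_one {q : ℂ} (hq : ‖q‖ < 1) {n : ℕ} (hn : n ≠ 0) : ‖q ^ n‖ < 1 := by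
  rw [norm_pow]
  exact pow_lt_one₀ (norm_nonneg q) hq hn

/-- The generating function `∑_j [n + j, j]_p X^j = 1 / (X; p)_{n+1}`. -/
noncomputable def gaussianSeries (p : ℂ) (n : ℕ) : ℂ⟦X⟧ :=
  mk fun j => qPoch p p (n + j) / (qPoch p p n * qPoch p p j)

theorem gaussian_eq (p : ℂ) (n j : ℕ) :
    gaussian p ((n : ℤ) + j) j = coeff j (gaussianSeries p n) := by
  have h : ((n : ℤ) + j).toNat = n + j := by omega
  simp [gaussian, gaussianSeries, h, mul_comm]

theorem gaussian_eq' (p : ℂ) (n j : ℕ) :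
    gaussian p ((n : ℤ) + j) n = coeff j (gaussianSeries p n) := by
  have h : ((n : ℤ) + j).toNat = n + j := by omega
  simp [gaussian, gaussianSeries, h]

theorem one_sub_X_mul_gaussianSeries_zero {p : ℂ} (hp : ‖p‖ < 1) :
    (1 - X) * gaussianSeries p 0 = 1 := by
  have h : ∀ j, coeff j (gaussianSeries p 0) = 1 := fun j => by
    simp [gaussianSeries, qPoch_zero, div_self (qPoch_ne_zero hp hp j)]
  ext j
  rw [sub_mul, one_mul, map_sub]
  cases j with
  | zero => simp [h]
  | succ j => simp [coeff_succ_X_mul, h, coeff_one]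

/-- This is the factorisation (X;p)_{n+2} = (1 - X)(pX;p)_{n+1}, checked on coefficients. -/
theorem one_sub_X_mul_gaussianSeries_succ {p : ℂ} (hp : ‖p‖ < 1) (n : ℕ) :
    (1 - X) * gaussianSeries p (n + 1) = rescale p (gaussianSeries p n) := by
  have h := qPoch_ne_zero hp hp
  ext j
  rw [sub_mul, one_mul, map_sub, coeff_rescale]
  cases j with
  | zero =>
    have := h n
    have := h (n + 1)
    simp [gaussianSeries, qPoch_zero]
    field_simp
  | succ j =>
    rw [coeff_succ_X_mul]
    simp only [gaussianSeries, coeff_mk]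
    have e1 : n + 1 + (j + 1) = n + (j + 1) + 1 := by ring
    have e2 : n + 1 + j = n + (j + 1) := by ring
    rw [e1, e2, qPoch_succ p p (n + (j + 1)), qPoch_succ p p n, qPoch_succ p p j]
    have h1 := h n
    have h2 := h j
    have h3 := one_sub_mul_pow_ne_zero hp hp n
    have h4 := one_sub_mul_pow_ne_zero hp hp j
    field_simp
    ring

/-- The product `1 / (X²; p²)_{n+1}` of `gaussianSeries p n` at `X` and at `-X`. -/
noncomputable def gaussianSq (p : ℂ) (n : ℕ) : ℂ⟦X⟧ :=
  gaussianSeries p n * rescale (-1) (gaussianSeries p n)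

theorem one_sub_X_sq_mul (f : ℂ⟦X⟧) :
    (1 - X ^ 2) * (f * rescale (-1) f) = ((1 - X) * f) * rescale (-1) ((1 - X) * f) := by
  rw [map_mul, map_sub, map_one, rescale_X]
  simp only [map_neg, map_one]
  ring

theorem one_sub_X_sq_mul_gaussianSq_zero {p : ℂ} (hp : ‖p‖ < 1) :
    (1 - X ^ 2) * gaussianSq p 0 = 1 := by
  rw [gaussianSq, one_sub_X_sq_mul, one_sub_X_mul_gaussianSeries_zero hp, map_one, one_mul]

theorem one_sub_X_sq_mul_gaussianSq_succ {p : ℂ} (hp : ‖p‖ < 1) (n : ℕ) :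
    (1 - X ^ 2) * gaussianSq p (n + 1) = rescale p (gaussianSq p n) := by
  rw [gaussianSq, one_sub_X_sq_mul, one_sub_X_mul_gaussianSeries_succ hp, gaussianSq, map_mul,
    rescale_rescale, rescale_rescale, mul_comm p]

theorem coeff_one_sub_X_sq_mul (f : ℂ⟦X⟧) (k : ℕ) :
    coeff (k + 2) ((1 - X ^ 2) * f) = coeff (k + 2) f - coeff k f := by
  rw [sub_mul, one_mul, map_sub, coeff_X_pow_mul]

/-- The polynomials `∑_{n, j} q^{n²} x^n (-1)^j [k - j, n]_{q²} [n + j, j]_{q²}`. -/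
noncomputable def slaterPoly (q x : ℂ) (k : ℕ) : ℂ :=
  ∑ a ∈ Finset.HasAntidiagonal.antidiagonal k,
    q ^ (a.1 ^ 2) * x ^ a.1 * coeff a.2 (gaussianSq (q ^ 2) a.1)

theorem slaterPoly_zero (q x : ℂ) : slaterPoly q x 0 = 1 := by
  rw [slaterPoly, Finset.Nat.antidiagonal_zero, Finset.sum_singleton, gaussianSq, coeff_mul,
    Finset.Nat.antidiagonal_zero, Finset.sum_singleton, coeff_rescale]
  simp [gaussianSeries, qPoch_zero]

theorem slaterPoly_one {q : ℂ} (hq : ‖q‖ < 1) (x : ℂ) : slaterPoly q x 1 = q * x := by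
  have h := qPoch_ne_zero (norm_pow_lt_one hq two_ne_zero) (norm_pow_lt_one hq two_ne_zero)
  simp [slaterPoly, gaussianSq, gaussianSeries, qPoch_zero, coeff_mul,
    Finset.Nat.antidiagonal_succ, div_self (h 1), coeff_rescale]

/-- Multiplying the series by 1 - X² produces the difference of the values at k + 2 and k, and also
turns index n + 1 into index n with X replaced by q²X. The factor gained is x q^{2n+1} q^{2j}, which
is constant on n + j = k + 1. -/
theorem slaterPoly_add_two {q : ℂ} (hq : ‖q‖ < 1) (x : ℂ) (k : ℕ) :
    slaterPoly q x (k + 2) = slaterPoly q x k + x * q ^ (2 * k + 3) * slaterPoly q x (k + 1) := by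
  have hp := norm_pow_lt_one hq two_ne_zero
  have key : slaterPoly q x (k + 2) - slaterPoly q x k =
      ∑ a ∈ Finset.HasAntidiagonal.antidiagonal (k + 2),
      q ^ (a.1 ^ 2) * x ^ a.1 * coeff a.2 ((1 - X ^ 2) * gaussianSq (q ^ 2) a.1) := by
    rw [slaterPoly, slaterPoly]
    simp only [Finset.Nat.sum_antidiagonal_succ', add_assoc, Nat.reduceAdd,
      coeff_one_sub_X_sq_mul, mul_sub, Finset.sum_sub_distrib]
    have h0 : ∀ f : ℂ⟦X⟧, coeff 0 ((1 - X ^ 2) * f) = coeff 0 f := fun f => by simp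
    have h1 : ∀ f : ℂ⟦X⟧, coeff 1 ((1 - X ^ 2) * f) = coeff 1 f := fun f => by
      rw [sub_mul, one_mul, map_sub, coeff_X_pow_mul']
      simp
    rw [h0, h1]
    ring
  rw [← sub_eq_iff_eq_add', key, Finset.Nat.sum_antidiagonal_succ,
    one_sub_X_sq_mul_gaussianSq_zero hp, slaterPoly, Finset.mul_sum, coeff_one, if_neg (by omega),
    mul_zero, zero_add]
  refine Finset.sum_congr rfl fun a ha => ?_
  rw [Finset.HasAntidiagonal.mem_antidiagonal] at ha
  rw [one_sub_X_sq_mul_gaussianSq_succ hp, coeff_rescale]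
  have e : 2 * k + 3 = 2 * a.1 + 1 + 2 * a.2 := by omega
  rw [e]
  ring

/-- For fixed n the j-sum is a Cauchy product: [k-j, n] is the coefficient of X^{k-n-j} in
1/(X;p)_{n+1}, with p = q², and (-1)^j [n+j, j] that of X^j in the same series at -X. -/
theorem finsum_eq_slaterPoly (q x : ℂ) (k : ℕ) (t : ℕ × ℕ → ℂ)
    (ht : ∀ p, t p = q ^ (p.1 ^ 2) * x ^ p.1 * (-1) ^ p.2 *
      gaussian (q ^ 2) ((k : ℤ) - p.2) p.1 * gaussian (q ^ 2) ((p.1 : ℤ) + p.2) p.2) :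
    ∑ᶠ p, t p = slaterPoly q x k := by
  have hz : ∀ n j, k < n + j → t (n, j) = 0 := fun n j h => by
    have h' : ¬ (0 ≤ (n : ℤ) ∧ (n : ℤ) ≤ (k : ℤ) - j) := by omega
    simp only [ht, gaussian, if_neg h', mul_zero, zero_mul]
  rw [finsum_eq_sum_of_support_subset (s := Finset.range (k + 1) ×ˢ Finset.range (k + 1)),
    Finset.sum_product, slaterPoly, Finset.Nat.sum_antidiagonal_eq_sum_range_succ_mk]
  · refine Finset.sum_congr rfl fun n hn => ?_
    rw [Finset.mem_range] at hn
    rw [gaussianSq, mul_comm (gaussianSeries _ _), coeff_mul,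
      Finset.Nat.sum_antidiagonal_eq_sum_range_succ_mk, Finset.mul_sum]
    rw [← Finset.sum_subset (s₁ := Finset.range (k - n + 1))]
    · refine Finset.sum_congr rfl fun j hj => ?_
      rw [Finset.mem_range] at hj
      have e : (k : ℤ) - j = (n : ℤ) + ((k - n - j : ℕ) : ℤ) := by omega
      simp only [ht]
      rw [e, gaussian_eq', gaussian_eq, coeff_rescale]
      ring
    · exact Finset.range_subset_range.mpr (by omega)
    · intro j _ hj
      rw [Finset.mem_range] at hj
      exact hz n j (by omega)
  · intro p hp
    by_contra h
    refine hp (hz p.1 p.2 ?_)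
    simp only [Finset.coe_product, Set.mem_prod, Finset.coe_range, Set.mem_Iio] at h
    omega

theorem aPoly_succ (k : ℕ) (q : ℂ) : aPoly (k + 1) q = slaterPoly q 1 k := by
  rw [aPoly, if_neg k.succ_ne_zero]
  exact finsum_eq_slaterPoly q 1 k _ fun p => by simp [aTerm]

theorem bPoly_add_two (k : ℕ) (q : ℂ) : bPoly (k + 2) q = slaterPoly q (q ^ 2) k := by
  rw [bPoly, if_neg (by omega)]
  refine finsum_eq_slaterPoly q (q ^ 2) k _ fun p => ?_
  have e : ((k + 2 : ℕ) : ℤ) - 2 - p.2 = (k : ℤ) - p.2 := by push_cast; ring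
  rw [bTerm, e, pow_add, pow_mul]

theorem bPoly_one (q : ℂ) : bPoly 1 q = 0 := by
  rw [bPoly, if_neg one_ne_zero]
  refine finsum_eq_zero_of_forall_eq_zero fun p => ?_
  have h : ¬ (0 ≤ (p.1 : ℤ) ∧ (p.1 : ℤ) ≤ ((1 : ℕ) : ℤ) - 2 - p.2) := by omega
  simp only [bTerm, gaussian, if_neg h, mul_zero, zero_mul]

theorem aPoly_add_two {q : ℂ} (hq : ‖q‖ < 1) (m : ℕ) :
    aPoly (m + 2) q = aPoly m q + q ^ (2 * m + 1) * aPoly (m + 1) q := by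
  cases m with
  | zero =>
    rw [aPoly_succ, aPoly_succ, slaterPoly_zero, slaterPoly_one hq]
    simp [aPoly]
  | succ m =>
    rw [aPoly_succ, aPoly_succ, aPoly_succ, slaterPoly_add_two hq]
    ring

/-- The cases m = 0, 1 are separate because b_0 = 1 is a convention and b_1 is a sum of zeros. -/
theorem bPoly_add_two_eq {q : ℂ} (hq : ‖q‖ < 1) (m : ℕ) :
    bPoly (m + 2) q = bPoly m q + q ^ (2 * m + 1) * bPoly (m + 1) q := by
  match m with
  | 0 =>
    rw [bPoly_add_two, slaterPoly_zero, zero_add, bPoly_one]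
    simp [bPoly]
  | 1 =>
    rw [bPoly_add_two, bPoly_add_two, slaterPoly_one hq, slaterPoly_zero, bPoly_one]
    ring
  | m + 2 =>
    rw [bPoly_add_two, bPoly_add_two, show m + 2 + 1 = m + 1 + 2 by ring, bPoly_add_two,
      slaterPoly_add_two hq]
    ring

end RogersSlater

/-! ### Finite triple product, Bailey's lemma, finite Rogers-Ramanujan identities -/

namespace RogersSlater

theorem hasSum_of_eq {ι : Type*} {f g : ι → ℂ} {a b : ℂ} (h : HasSum f a) (hf : ∀ i, g i = f i)
    (ha : b = a) : HasSum g b := by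
  rw [ha, funext hf]
  exact h

/-- The reciprocal `1 / (q; q)_n`, extended by `0` to negative `n`. -/
noncomputable def qRecip (q : ℂ) (n : ℤ) : ℂ :=
  if 0 ≤ n then 1 / qPoch q q n.toNat else 0

theorem qRecip_natCast (q : ℂ) (n : ℕ) : qRecip q n = 1 / qPoch q q n := by
  simp [qRecip]

theorem qRecip_zero (q : ℂ) : qRecip q 0 = 1 := by
  simpa [qPoch_zero] using qRecip_natCast q 0

theorem qRecip_of_neg (q : ℂ) {n : ℤ} (hn : n < 0) : qRecip q n = 0 :=
  if_neg (by omega)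

theorem nonneg_of_qRecip_ne_zero {q : ℂ} {n : ℤ} (h : qRecip q n ≠ 0) : 0 ≤ n := by
  by_contra hn
  exact h (qRecip_of_neg q (by omega))

theorem one_sub_pow_mul_qRecip {q : ℂ} (hq : ‖q‖ < 1) (n : ℕ) :
    (1 - q ^ (n + 1)) * qRecip q ((n + 1 : ℕ) : ℤ) = qRecip q n := by
  rw [qRecip_natCast, qRecip_natCast, qPoch_succ, pow_succ']
  have h1 := qPoch_ne_zero hq hq n
  have h2 := one_sub_mul_pow_ne_zero hq hq n
  field_simp

/-- At n = 0 the factor 1 - q^n vanishes, so the relation holds for every integer and sums over ℤ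
need no boundary cases. -/
theorem qRecip_sub_one {q : ℂ} (hq : ‖q‖ < 1) (n : ℤ) :
    qRecip q (n - 1) = (1 - q ^ n) * qRecip q n := by
  rcases lt_trichotomy n 0 with h | rfl | h
  · rw [qRecip_of_neg q h, qRecip_of_neg q (by omega), mul_zero]
  · rw [qRecip_of_neg q (by omega)]
    simp
  · obtain ⟨k, rfl⟩ : ∃ k : ℕ, n = (k + 1 : ℕ) := ⟨(n - 1).toNat, by omega⟩
    rw [zpow_natCast, one_sub_pow_mul_qRecip hq]
    congr 1
    push_cast
    ring

theorem one_sub_pow_succ_ne_zero {q : ℂ} (hq : ‖q‖ < 1) (n : ℕ) : 1 - q ^ (n + 1) ≠ 0 := by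
  simpa only [pow_succ'] using one_sub_mul_pow_ne_zero hq hq n

/-- A limiting case of the `q`-Vandermonde summation. -/
theorem hasSum_qVandermonde {q : ℂ} (hq : ‖q‖ < 1) (hq0 : q ≠ 0) (A e : ℤ) :
    HasSum (fun t : ℤ => q ^ (t ^ 2 + e * t) * qRecip q (A - t) * qRecip q t * qRecip q (t + e))
      (qRecip q A * qRecip q (A + e)) := by
  rcases lt_or_ge A 0 with hA | hA
  · rw [qRecip_of_neg q hA, zero_mul]
    convert hasSum_zero with t
    rcases lt_or_ge t 0 with ht | ht
    · simp [qRecip_of_neg q ht]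
    · simp [qRecip_of_neg q (show A - t < 0 by omega)]
  lift A to ℕ using hA
  induction A generalizing e with
  | zero =>
    have h := hasSum_single (f := fun t : ℤ => q ^ (t ^ 2 + e * t) * qRecip q ((0 : ℕ) - t) *
      qRecip q t * qRecip q (t + e)) 0 (fun t ht => by
        rcases lt_or_gt_of_ne ht with ht | ht
        · simp [qRecip_of_neg q ht]
        · simp [qRecip_of_neg q (show -t < 0 by omega)])
    simpa [qRecip_zero] using h
  | succ A ih =>
    -- Pascal-type splitting 1 - q^{A+1} = (1 - q^{A+1-t}) + q^{A+1-t}(1 - q^t); the second piece is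
    -- the case e + 1 at t - 1.
    have h1 := ih e
    have h2 := (Equiv.subRight (1 : ℤ)).hasSum_iff.mpr (ih (e + 1))
    have h3 := (h1.add (h2.mul_left (q ^ ((A : ℤ) + 1 + e)))).mul_left (1 - q ^ (A + 1))⁻¹
    have hne := one_sub_pow_succ_ne_zero hq A
    refine hasSum_of_eq h3 (fun t => ?_) ?_
    · rw [eq_inv_mul_iff_mul_eq₀ hne]
      have r1 := qRecip_sub_one hq ((A : ℤ) + 1 - t)
      have r2 := qRecip_sub_one hq t
      simp only [Function.comp, Equiv.subRight_apply]
      rw [show (A : ℤ) - (t - 1) = A + 1 - t by ring, show t - 1 + (e + 1) = t + e by ring,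
        show (A : ℤ) - t = A + 1 - t - 1 by ring, r1, r2,
        show (((A + 1 : ℕ) : ℤ) - t) = A + 1 - t by push_cast; ring]
      have hz : q ^ ((A : ℤ) + 1 + e) * q ^ ((t - 1) ^ 2 + (e + 1) * (t - 1)) =
          q ^ (t ^ 2 + e * t) * q ^ ((A : ℤ) + 1 - t) := by
        rw [← zpow_add₀ hq0, ← zpow_add₀ hq0]
        congr 1
        ring
      have hA1 : q ^ (A + 1) = q ^ ((A : ℤ) + 1 - t) * q ^ t := by
        rw [← zpow_add₀ hq0, ← zpow_natCast]
        congr 1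
        push_cast
        ring
      rw [hA1]
      linear_combination (-(qRecip q (A + 1 - t) * ((1 - q ^ t) * qRecip q t) *
        qRecip q (t + e))) * hz
    · rw [eq_inv_mul_iff_mul_eq₀ hne, ← mul_assoc, one_sub_pow_mul_qRecip hq]
      have r := qRecip_sub_one hq ((A : ℤ) + 1 + e)
      rw [show (A : ℤ) + e = A + 1 + e - 1 by ring, r,
        show (((A + 1 : ℕ) : ℤ) + e) = A + 1 + e by push_cast; ring,
        show (A : ℤ) + (e + 1) = A + 1 + e by ring]
      ring

/-- The general term `(-1)^j q^{j(j-1)/2} z^j` of the theta series. -/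
noncomputable def thetaTerm (q z : ℂ) (j : ℤ) : ℂ :=
  (-1) ^ j * q ^ (j * (j - 1) / 2) * z ^ j

theorem two_mul_triangle (j : ℤ) : 2 * (j * (j - 1) / 2) = j * (j - 1) :=
  Int.two_mul_ediv_two_of_even (by simpa [sub_add_cancel] using Int.even_mul_pred_self j)

theorem thetaTerm_add_one {q z : ℂ} (hq0 : q ≠ 0) (hz : z ≠ 0) (j : ℤ) :
    thetaTerm q z (j + 1) = -z * q ^ j * thetaTerm q z j := by
  have h : (j + 1) * (j + 1 - 1) / 2 = j * (j - 1) / 2 + j := by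
    have h1 := two_mul_triangle j
    have h2 := two_mul_triangle (j + 1)
    linarith
  rw [thetaTerm, thetaTerm, h, zpow_add₀ hq0, zpow_add_one₀ hz,
    zpow_add_one₀ (by norm_num : (-1 : ℂ) ≠ 0)]
  ring

/-- The finite form of the Jacobi triple product. -/
theorem hasSum_finite_tripleProduct {q z : ℂ} (hq : ‖q‖ < 1) (hq0 : q ≠ 0) (hz : z ≠ 0)
    (A B : ℕ) :
    HasSum (fun j : ℤ => thetaTerm q z j * qRecip q (A - j) * qRecip q (B + j))
      (qPoch z q A * qPoch (q / z) q B * qRecip q ((A + B : ℕ) : ℤ)) := by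
  induction A with
  | zero =>
    induction B with
    | zero =>
      have h := hasSum_single (f := fun j : ℤ => thetaTerm q z j * qRecip q ((0 : ℕ) - j) *
        qRecip q ((0 : ℕ) + j)) 0 (fun t ht => by
          rcases lt_or_gt_of_ne ht with ht | ht
          · simp [qRecip_of_neg q ht]
          · simp [qRecip_of_neg q (show -t < 0 by omega)])
      simpa [qRecip_zero, qPoch_zero, thetaTerm] using h
    | succ B ih =>
      -- Here 1 - q^{B+1} = (1 - q^{B+1+j}) + q^{B+1+j}(1 - q^{-j}); the second piece is the old
      -- term at j + 1.
      have h2 := (Equiv.addRight (1 : ℤ)).hasSum_iff.mpr ih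
      have h3 := (ih.add (h2.mul_left (-(q ^ (B + 1) / z)))).mul_left (1 - q ^ (B + 1))⁻¹
      have hne := one_sub_pow_succ_ne_zero hq B
      refine hasSum_of_eq h3 (fun j => ?_) ?_
      · rw [eq_inv_mul_iff_mul_eq₀ hne]
        simp only [Function.comp, Equiv.coe_addRight]
        have r1 := qRecip_sub_one hq (-j)
        have r2 := qRecip_sub_one hq ((B : ℤ) + 1 + j)
        have hB : q ^ (B + 1) = q ^ ((B : ℤ) + 1 + j) * q ^ (-j) := by
          rw [← zpow_add₀ hq0, ← zpow_natCast]
          congr 1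
          push_cast
          ring
        have hj : q ^ (-j) * q ^ j = 1 := by rw [← zpow_add₀ hq0]; simp
        rw [thetaTerm_add_one hq0 hz, show (((0 : ℕ) : ℤ) - (j + 1)) = -j - 1 by push_cast; ring,
          show (((0 : ℕ) : ℤ) - j) = -j by push_cast; ring, r1,
          show (B : ℤ) + (j + 1) = B + 1 + j by ring, show (B : ℤ) + j = B + 1 + j - 1 by ring, r2,
          show (((B + 1 : ℕ) : ℤ) + j) = B + 1 + j by push_cast; ring, hB]
        linear_combination (-(q ^ ((B : ℤ) + 1 + j) * (1 - q ^ (-j)) * thetaTerm q z j *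
          qRecip q (-j) * qRecip q (B + 1 + j))) * (hj + q ^ (-j) * q ^ j * mul_inv_cancel₀ hz)
      · rw [eq_inv_mul_iff_mul_eq₀ hne, qPoch_succ, zero_add, zero_add,
          ← one_sub_pow_mul_qRecip hq B]
        field_simp
        ring
  | succ A ih =>
    -- Here 1 - q^{A+B+1} = (1 - q^{A+1-j}) + q^{A+1-j}(1 - q^{B+j}); the second piece is the old
    -- term at j - 1.
    have h2 := (Equiv.subRight (1 : ℤ)).hasSum_iff.mpr ih
    have h3 := (ih.add (h2.mul_left (-(z * q ^ A)))).mul_left (1 - q ^ (A + B + 1))⁻¹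
    have hne := one_sub_pow_succ_ne_zero hq (A + B)
    refine hasSum_of_eq h3 (fun j => ?_) ?_
    · rw [eq_inv_mul_iff_mul_eq₀ hne]
      simp only [Function.comp, Equiv.subRight_apply]
      have r1 := qRecip_sub_one hq ((A : ℤ) + 1 - j)
      have r2 := qRecip_sub_one hq ((B : ℤ) + j)
      have hB : q ^ (A + B + 1) = q ^ ((A : ℤ) + 1 - j) * q ^ ((B : ℤ) + j) := by
        rw [← zpow_add₀ hq0, ← zpow_natCast]
        congr 1
        push_cast
        ring
      have hA : q ^ A = q ^ ((A : ℤ) + 1 - j) * q ^ (j - 1) := by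
        rw [← zpow_add₀ hq0, ← zpow_natCast]
        congr 1
        ring
      have w := thetaTerm_add_one hq0 hz (j - 1)
      rw [sub_add_cancel] at w
      rw [show (A : ℤ) - (j - 1) = A + 1 - j by ring, show (A : ℤ) - j = A + 1 - j - 1 by ring, r1,
        show (B : ℤ) + (j - 1) = B + j - 1 by ring, r2,
        show (((A + 1 : ℕ) : ℤ) - j) = A + 1 - j by push_cast; ring, hB, hA, w]
      ring
    · rw [eq_inv_mul_iff_mul_eq₀ hne, qPoch_succ, show A + 1 + B = A + B + 1 by ring,
        ← one_sub_pow_mul_qRecip hq (A + B)]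
      ring

/-- Bailey's lemma, in the limiting case used for the Rogers-Ramanujan identities. -/
theorem hasSum_bailey {q : ℂ} (hq : ‖q‖ < 1) (hq0 : q ≠ 0) (c : ℕ) {α β : ℤ → ℂ}
    (hαβ : ∀ s : ℤ, HasSum (fun j : ℤ => α j * qRecip q (s - j) * qRecip q (s + c + j)) (β s))
    (N : ℤ) {T : ℂ} (hT : HasSum (fun s : ℤ => q ^ (s ^ 2 + c * s) * qRecip q (N - s) * β s) T) :
    HasSum (fun j : ℤ => q ^ (j ^ 2 + c * j) * α j * qRecip q (N - j) * qRecip q (N + c + j)) T := by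
  set F : ℤ × ℤ → ℂ := fun x => q ^ (x.1 ^ 2 + c * x.1) * qRecip q (N - x.1) *
    (α x.2 * qRecip q (x.1 - x.2) * qRecip q (x.1 + c + x.2)) with hF
  have hfin : (Function.support F).Finite := by
    refine (Finset.Icc (-c : ℤ) N ×ˢ Finset.Icc (-N - c : ℤ) N).finite_toSet.subset ?_
    intro x hx
    have h1 : 0 ≤ N - x.1 := nonneg_of_qRecip_ne_zero (q := q) fun h => hx (by simp [hF, h])
    have h2 : 0 ≤ x.1 - x.2 := nonneg_of_qRecip_ne_zero (q := q) fun h => hx (by simp [hF, h])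
    have h3 : 0 ≤ x.1 + c + x.2 :=
      nonneg_of_qRecip_ne_zero (q := q) fun h => hx (by simp [hF, h])
    simp only [Finset.coe_product, Finset.coe_Icc, Set.mem_prod, Set.mem_Icc]
    omega
  have hs : HasSum F (∑' x, F x) := (summable_of_hasFiniteSupport hfin).hasSum
  have h1 := hs.prod_fiberwise fun s => (hαβ s).mul_left (q ^ (s ^ 2 + c * s) * qRecip q (N - s))
  rw [hT.unique h1]
  refine ((Equiv.prodComm ℤ ℤ).hasSum_iff.mpr hs).prod_fiberwise fun j => ?_
  -- After interchanging the sums, the inner s-sum is q-Vandermonde in t = s - j.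
  have hv := (Equiv.subRight j).hasSum_iff.mpr (hasSum_qVandermonde hq hq0 (N - j) (2 * j + c))
  have hv' := hv.mul_left (q ^ (j ^ 2 + c * j) * α j)
  refine hasSum_of_eq hv' (fun s => ?_) ?_
  · simp only [Function.comp, Equiv.subRight_apply, hF, Equiv.prodComm_apply, Prod.swap]
    rw [show N - j - (s - j) = N - s by ring, show s - j + (2 * j + c) = s + c + j by ring,
      show s ^ 2 + (c : ℤ) * s = (j ^ 2 + c * j) + ((s - j) ^ 2 + (2 * j + c) * (s - j)) by ring,
      zpow_add₀ hq0]
    ring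
  · rw [show N - j + (2 * j + c) = N + c + j by ring]
    ring

/-- The unit Bailey pair: the finite triple product at z = 1 contains (1;q)_s, which vanishes for s
> 0. For s < 0 the two indices add up to 2s + c < 0, which uses c ≤ 1. -/
theorem hasSum_thetaTerm_one {q : ℂ} (hq : ‖q‖ < 1) (hq0 : q ≠ 0) {c : ℕ} (hc : c ≤ 1) (s : ℤ) :
    HasSum (fun j : ℤ => thetaTerm q 1 j * qRecip q (s - j) * qRecip q (s + c + j))
      (if s = 0 then 1 else 0) := by
  rcases lt_or_ge s 0 with hs | hs
  · rw [if_neg hs.ne]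
    convert hasSum_zero with j
    rcases lt_or_ge (s - j) 0 with h | h
    · simp [qRecip_of_neg q h]
    · simp [qRecip_of_neg q (show s + c + j < 0 by omega)]
  lift s to ℕ using hs
  have h := hasSum_finite_tripleProduct hq hq0 one_ne_zero s (s + c)
  convert h using 1
  · push_cast; rfl
  · cases s with
    | zero =>
      rw [qRecip_natCast]
      have := qPoch_ne_zero hq hq c
      simp [qPoch_zero]
      field_simp
    | succ s =>
      have : qPoch 1 q (s + 1) = 0 := by
        rw [qPoch, Finset.prod_range_succ']
        simp
      rw [this]
      simp
      omega

/-- The finite form of the Rogers-Ramanujan identities. -/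
theorem hasSum_finite_rogersRamanujan {q : ℂ} (hq : ‖q‖ < 1) (hq0 : q ≠ 0) {c : ℕ} (hc : c ≤ 1)
    (N : ℤ) {T : ℂ}
    (hT : HasSum (fun s : ℤ => q ^ (s ^ 2 + c * s) * qRecip q (N - s) * qRecip q s) T) :
    HasSum (fun j : ℤ => q ^ (j ^ 2 + c * j) * (q ^ (j ^ 2 + c * j) * thetaTerm q 1 j) *
      qRecip q (N - j) * qRecip q (N + c + j)) T := by
  -- The inner application sends the unit pair to β = 1/(q;q)_M, and this one iterates.
  refine hasSum_bailey hq hq0 c (β := qRecip q) (fun M => ?_) N hT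
  refine hasSum_bailey hq hq0 c (fun s => hasSum_thetaTerm_one hq hq0 hc s) M ?_
  have h := hasSum_single (f := fun s : ℤ => q ^ (s ^ 2 + c * s) * qRecip q (M - s) *
    (if s = 0 then 1 else 0)) 0 (fun t ht => by simp [ht])
  simpa using h

end RogersSlater

/-! ### Limits: the Jacobi triple product and the Rogers-Ramanujan identities -/

namespace RogersSlater

open Filter Topology

theorem tendsto_one_div_qPoch {q : ℂ} (hq : ‖q‖ < 1) :
    Tendsto (fun n => 1 / qPoch q q n) atTop (𝓝 (1 / qPochInf q q)) :=
  tendsto_const_nhds.div (tendsto_qPoch q hq) (qPochInf_ne_zero hq hq)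

theorem exists_norm_le_of_tendsto {u : ℕ → ℂ} {l : ℂ} (h : Tendsto u atTop (𝓝 l)) :
    ∃ C, 0 ≤ C ∧ ∀ n, ‖u n‖ ≤ C := by
  obtain ⟨C, hC⟩ := h.norm.bddAbove_range
  have hC' : ∀ n, ‖u n‖ ≤ C := fun n => hC ⟨n, rfl⟩
  exact ⟨C, (norm_nonneg _).trans (hC' 0), hC'⟩

theorem exists_norm_qRecip_le {q : ℂ} (hq : ‖q‖ < 1) : ∃ C, 0 ≤ C ∧ ∀ n, ‖qRecip q n‖ ≤ C := by
  obtain ⟨C, h0, hC⟩ := exists_norm_le_of_tendsto (tendsto_one_div_qPoch hq)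
  refine ⟨C, h0, fun n => ?_⟩
  rcases lt_or_ge n 0 with hn | hn
  · rwa [qRecip_of_neg q hn, norm_zero]
  · lift n to ℕ using hn
    rw [qRecip_natCast]
    exact hC n

theorem tendsto_qRecip_add {q : ℂ} (hq : ‖q‖ < 1) (k : ℤ) :
    Tendsto (fun N : ℕ => qRecip q (N + k)) atTop (𝓝 (1 / qPochInf q q)) := by
  have h : Tendsto (fun N : ℕ => ((N : ℤ) + k).toNat) atTop atTop :=
    tendsto_atTop.mpr fun b => by
      filter_upwards [eventually_ge_atTop (b + k.natAbs)] with N hN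
      omega
  refine ((tendsto_one_div_qPoch hq).comp h).congr' ?_
  filter_upwards [eventually_ge_atTop k.natAbs] with N hN
  rw [qRecip, if_pos (by omega), Function.comp]

theorem tendsto_tsum_mul {ι : Type*} {a : ι → ℂ} {b : ℕ → ι → ℂ} {L : ι → ℂ} {C : ℝ}
    (ha : Summable fun i => ‖a i‖) (hb : ∀ N i, ‖b N i‖ ≤ C)
    (hL : ∀ i, Tendsto (fun N => b N i) atTop (𝓝 (L i))) :
    Tendsto (fun N => ∑' i, a i * b N i) atTop (𝓝 (∑' i, a i * L i)) := by
  refine tendsto_tsum_of_dominated_convergence (ha.mul_right C) (fun i => (hL i).const_mul _)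
    (Eventually.of_forall fun N i => ?_)
  rw [norm_mul]
  exact mul_le_mul_of_nonneg_left (hb N i) (norm_nonneg _)

/-- Comparison with a two-sided geometric series. The slack 1 is needed for e(j) = j² + j at j = -1.
-/
theorem summable_norm_zpow {q : ℂ} (hq : ‖q‖ < 1) (hq0 : q ≠ 0) {e : ℤ → ℤ}
    (he : ∀ j, |j| ≤ e j + 1) : Summable fun j => ‖q ^ e j‖ := by
  have h0 : 0 < ‖q‖ := norm_pos_iff.mpr hq0
  have hg := summable_geometric_of_lt_one (norm_nonneg q) hq
  have h : Summable fun j : ℤ => ‖q‖ ^ j.natAbs :=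
    summable_int_iff_summable_nat_and_neg.mpr ⟨by simpa using hg, by simpa using hg⟩
  refine Summable.of_nonneg_of_le (fun _ => norm_nonneg _) (fun j => ?_) (h.mul_left ‖q‖⁻¹)
  rw [norm_zpow, ← zpow_natCast, ← zpow_neg_one, ← zpow_add₀ h0.ne']
  refine zpow_le_zpow_right_of_le_one₀ h0 hq.le ?_
  have := he j
  have := Int.natCast_natAbs j
  omega

/-- Let A = B = N → ∞ in the finite triple product; the reciprocal factors are uniformly bounded, so
dominated convergence applies. -/
theorem tsum_thetaTerm {q z : ℂ} (hq : ‖q‖ < 1) (hq0 : q ≠ 0) (hz : z ≠ 0)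
    (hs : Summable fun j => ‖thetaTerm q z j‖) :
    ∑' j, thetaTerm q z j = qPochInf z q * qPochInf (q / z) q * qPochInf q q := by
  obtain ⟨C, h0, hC⟩ := exists_norm_qRecip_le hq
  have h1 := tendsto_tsum_mul (b := fun N j => qRecip q (N + -j) * qRecip q (N + j)) hs
    (fun N j => norm_mul_le_of_le (hC _) (hC _))
    (fun j => (tendsto_qRecip_add hq (-j)).mul (tendsto_qRecip_add hq j))
  have h2 := ((tendsto_qPoch z hq).mul (tendsto_qPoch (q / z) hq)).mul
    ((tendsto_one_div_qPoch hq).comp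
      (tendsto_atTop_mono (fun N => Nat.le_add_left N N) tendsto_id))
  have h := tendsto_nhds_unique h1 (h2.congr fun N => by
    rw [Function.comp, ← qRecip_natCast]
    simpa only [sub_eq_add_neg, mul_assoc] using
      (hasSum_finite_tripleProduct hq hq0 hz N N).tsum_eq.symm)
  rw [tsum_mul_right] at h
  have := qPochInf_ne_zero hq hq
  field_simp at h
  linear_combination h

theorem rogersRamanujan_theta {q : ℂ} (hq : ‖q‖ < 1) (hq0 : q ≠ 0) {c : ℕ} (hc : c ≤ 1)
    (hs : Summable fun j : ℤ => ‖q ^ (j ^ 2 + c * j) * (q ^ (j ^ 2 + c * j) * thetaTerm q 1 j)‖) :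
    qPochInf q q * ∑' s : ℤ, q ^ (s ^ 2 + c * s) * qRecip q s =
      ∑' j : ℤ, q ^ (j ^ 2 + c * j) * (q ^ (j ^ 2 + c * j) * thetaTerm q 1 j) := by
  obtain ⟨C, h0, hC⟩ := exists_norm_qRecip_le hq
  have hsq : Summable fun s : ℤ => ‖q ^ (s ^ 2 + c * s)‖ := summable_norm_zpow hq hq0 fun j => by
    interval_cases c <;> rcases abs_cases j with ⟨h, _⟩ | ⟨h, _⟩ <;> rw [h] <;>
      push_cast <;> nlinarith
  have h1 := tendsto_tsum_mul
    (b := fun N j => qRecip q (N + -j) * qRecip q (N + (c + j))) hs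
    (fun N j => norm_mul_le_of_le (hC _) (hC _))
    (fun j => (tendsto_qRecip_add hq (-j)).mul (tendsto_qRecip_add hq (c + j)))
  have h2 := tendsto_tsum_mul (b := fun N s => qRecip q (N + -s) * qRecip q s) hsq
    (fun N j => norm_mul_le_of_le (hC _) (hC _))
    (fun s => (tendsto_qRecip_add hq (-s)).mul tendsto_const_nhds)
  have h := tendsto_nhds_unique h1 (h2.congr fun N => by
    have hf : HasSum (fun s : ℤ => q ^ (s ^ 2 + c * s) * qRecip q (N - s) * qRecip q s)
        (∑' s : ℤ, q ^ (s ^ 2 + c * s) * qRecip q (N - s) * qRecip q s) := by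
      refine (summable_of_hasFiniteSupport
        ((Finset.Icc (0 : ℤ) N).finite_toSet.subset fun s hx => ?_)).hasSum
      have h1 : 0 ≤ N - s := nonneg_of_qRecip_ne_zero (q := q) fun h => hx (by simp [h])
      have h2 : 0 ≤ s := nonneg_of_qRecip_ne_zero (q := q) fun h => hx (by simp [h])
      simp only [Finset.coe_Icc, Set.mem_Icc]
      omega
    simpa only [sub_eq_add_neg, mul_assoc, add_assoc] using
      (hasSum_finite_rogersRamanujan hq hq0 hc N hf).tsum_eq.symm)
  rw [tsum_mul_right, tsum_congr fun s => mul_left_comm _ (1 / qPochInf q q) _, tsum_mul_left] at h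
  have := qPochInf_ne_zero hq hq
  generalize (∑' s : ℤ, q ^ (s ^ 2 + c * s) * qRecip q s) = B at h ⊢
  generalize (∑' j : ℤ, q ^ (j ^ 2 + c * j) * (q ^ (j ^ 2 + c * j) * thetaTerm q 1 j)) = A at h ⊢
  field_simp at h
  exact h.symm

/-- Compare exponents: 2(j² + cj) + j(j-1)/2 = 5 j(j-1)/2 + (2 + 2c) j. -/
theorem thetaTerm_pow_five {q : ℂ} (hq0 : q ≠ 0) (c : ℕ) (j : ℤ) :
    thetaTerm (q ^ 5) (q ^ (2 + 2 * c)) j =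
      q ^ (j ^ 2 + c * j) * (q ^ (j ^ 2 + c * j) * thetaTerm q 1 j) := by
  have h := two_mul_triangle j
  have e : ((5 : ℕ) : ℤ) * (j * (j - 1) / 2) + ((2 + 2 * c : ℕ) : ℤ) * j =
      (j ^ 2 + c * j) + ((j ^ 2 + c * j) + j * (j - 1) / 2) := by
    push_cast
    linear_combination 2 * h
  rw [thetaTerm, thetaTerm, ← zpow_natCast q 5, ← zpow_natCast q (2 + 2 * c), ← zpow_mul,
    ← zpow_mul, mul_assoc, ← zpow_add₀ hq0, e, zpow_add₀ hq0 (j ^ 2 + c * j),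
    zpow_add₀ hq0 (j ^ 2 + c * j), one_zpow]
  ring

theorem summable_norm_thetaTerm_pow_five {q : ℂ} (hq : ‖q‖ < 1) (hq0 : q ≠ 0) {c : ℕ}
    (hc : c ≤ 1) :
    Summable fun j : ℤ => ‖q ^ (j ^ 2 + c * j) * (q ^ (j ^ 2 + c * j) * thetaTerm q 1 j)‖ := by
  have h := summable_norm_zpow hq hq0
    (e := fun j => (j ^ 2 + c * j) + ((j ^ 2 + c * j) + j * (j - 1) / 2)) fun j => by
      have h := two_mul_triangle j
      generalize j * (j - 1) / 2 = t at *
      interval_cases c <;> rcases abs_cases j with ⟨h', _⟩ | ⟨h', _⟩ <;> rw [h'] <;> push_cast <;>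
        nlinarith
  refine h.congr fun j => ?_
  rw [zpow_add₀ hq0 (j ^ 2 + c * j), zpow_add₀ hq0 (j ^ 2 + c * j), thetaTerm]
  simp

theorem qPoch_five_mul (q : ℂ) (N : ℕ) :
    qPoch q q (5 * N) = qPoch q (q ^ 5) N * qPoch (q ^ 2) (q ^ 5) N * qPoch (q ^ 3) (q ^ 5) N *
      qPoch (q ^ 4) (q ^ 5) N * qPoch (q ^ 5) (q ^ 5) N := by
  induction N with
  | zero => simp [qPoch_zero]
  | succ N ih =>
    rw [show 5 * (N + 1) = 5 * N + 1 + 1 + 1 + 1 + 1 by ring]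
    simp only [qPoch_succ]
    rw [ih]
    ring

theorem qPochInf_eq_mul_pow_five {q : ℂ} (hq : ‖q‖ < 1) :
    qPochInf q q = qPochInf q (q ^ 5) * qPochInf (q ^ 2) (q ^ 5) * qPochInf (q ^ 3) (q ^ 5) *
      qPochInf (q ^ 4) (q ^ 5) * qPochInf (q ^ 5) (q ^ 5) := by
  have h5 := norm_pow_lt_one hq (n := 5) (by norm_num)
  have h1 : Tendsto (fun N => qPoch q q (5 * N)) atTop (𝓝 (qPochInf q q)) :=
    (tendsto_qPoch q hq).comp (tendsto_id.const_mul_atTop' (by norm_num))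
  refine tendsto_nhds_unique h1 (Tendsto.congr (fun N => (qPoch_five_mul q N).symm) ?_)
  exact ((((tendsto_qPoch _ h5).mul (tendsto_qPoch _ h5)).mul (tendsto_qPoch _ h5)).mul
    (tendsto_qPoch _ h5)).mul (tendsto_qPoch _ h5)

theorem summable_norm_mul_of_pow_sq {q : ℂ} (hq : ‖q‖ < 1) (d : ℕ) {u : ℕ → ℂ} {C : ℝ}
    (hu : ∀ n, ‖u n‖ ≤ C) : Summable fun n => ‖q ^ (n ^ 2 + d * n) * u n‖ := by
  refine Summable.of_nonneg_of_le (fun _ => norm_nonneg _) (fun n => ?_)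
    ((summable_geometric_of_lt_one (norm_nonneg q) hq).mul_right C)
  rw [norm_mul, norm_pow]
  refine mul_le_mul (pow_le_pow_of_le_one (norm_nonneg q) hq.le ?_) (hu n) (norm_nonneg _)
    (by positivity)
  nlinarith [Nat.le_self_pow two_ne_zero n, Nat.zero_le (d * n)]

theorem tsum_int_eq_tsum_nat {q : ℂ} (c : ℕ) :
    ∑' s : ℤ, q ^ (s ^ 2 + c * s) * qRecip q s =
      ∑' n : ℕ, q ^ (n ^ 2 + c * n) * (1 / qPoch q q n) := by
  rw [← Nat.cast_injective.tsum_eq (f := fun s : ℤ => q ^ (s ^ 2 + c * s) * qRecip q s)]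
  · refine tsum_congr fun n => ?_
    rw [qRecip_natCast, ← zpow_natCast]
    push_cast
    rfl
  · intro s hs
    have h : 0 ≤ s := nonneg_of_qRecip_ne_zero (q := q) fun h => hs (by simp [h])
    exact ⟨s.toNat, by simp [h]⟩

theorem rogersRamanujan {q : ℂ} (hq : ‖q‖ < 1) (hq0 : q ≠ 0) {c : ℕ} (hc : c ≤ 1) :
    qPochInf q q * ∑' n : ℕ, q ^ (n ^ 2 + c * n) * (1 / qPoch q q n) =
      qPochInf (q ^ (2 + 2 * c)) (q ^ 5) * qPochInf (q ^ 5 / q ^ (2 + 2 * c)) (q ^ 5) *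
        qPochInf (q ^ 5) (q ^ 5) := by
  have hs := summable_norm_thetaTerm_pow_five hq hq0 hc
  rw [← tsum_int_eq_tsum_nat, rogersRamanujan_theta hq hq0 hc hs,
    ← tsum_thetaTerm (norm_pow_lt_one hq (by norm_num)) (pow_ne_zero _ hq0) (pow_ne_zero _ hq0)]
  · exact tsum_congr fun j => (thetaTerm_pow_five hq0 c j).symm
  · exact hs.congr fun j => by rw [thetaTerm_pow_five hq0]

theorem tsum_of_q_eq_zero (c : ℕ) :
    ∑' n : ℕ, (0 : ℂ) ^ (n ^ 2 + c * n) * (1 / qPoch 0 0 n) = 1 := by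
  rw [tsum_eq_single 0 fun n hn => by simp [hn]]
  simp [qPoch_zero]

/-- The first Rogers-Ramanujan identity. -/
theorem rogersRamanujan_zero {q : ℂ} (hq : ‖q‖ < 1) :
    ∑' n : ℕ, q ^ (n ^ 2 + 0 * n) * (1 / qPoch q q n) =
      1 / (qPochInf q (q ^ 5) * qPochInf (q ^ 4) (q ^ 5)) := by
  -- The theta argument uses negative powers of q; at q = 0 both sides equal 1.
  rcases eq_or_ne q 0 with rfl | hq0
  · rw [tsum_of_q_eq_zero]
    simp [qPochInf]
  have h := rogersRamanujan hq hq0 (c := 0) (by norm_num)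
  have e : q ^ 5 / q ^ (2 + 2 * 0) = q ^ 3 := by field_simp
  have h5 := norm_pow_lt_one hq (n := 5) (by norm_num)
  have n1 := qPochInf_ne_zero hq h5
  have n2 := qPochInf_ne_zero (norm_pow_lt_one hq (n := 2) (by norm_num)) h5
  have n3 := qPochInf_ne_zero (norm_pow_lt_one hq (n := 3) (by norm_num)) h5
  have n4 := qPochInf_ne_zero (norm_pow_lt_one hq (n := 4) (by norm_num)) h5
  have n5 := qPochInf_ne_zero h5 h5
  rw [e, mul_zero, add_zero, qPochInf_eq_mul_pow_five hq] at h
  rw [eq_div_iff (mul_ne_zero n1 n4)]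
  refine mul_left_cancel₀ (mul_ne_zero (mul_ne_zero n2 n3) n5) ?_
  linear_combination h

/-- The second Rogers-Ramanujan identity. -/
theorem rogersRamanujan_one {q : ℂ} (hq : ‖q‖ < 1) :
    ∑' n : ℕ, q ^ (n ^ 2 + 1 * n) * (1 / qPoch q q n) =
      1 / (qPochInf (q ^ 2) (q ^ 5) * qPochInf (q ^ 3) (q ^ 5)) := by
  rcases eq_or_ne q 0 with rfl | hq0
  · rw [tsum_of_q_eq_zero]
    simp [qPochInf]
  have h := rogersRamanujan hq hq0 (c := 1) le_rfl
  have e : q ^ 5 / q ^ (2 + 2 * 1) = q := by field_simp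
  have h5 := norm_pow_lt_one hq (n := 5) (by norm_num)
  have n1 := qPochInf_ne_zero hq h5
  have n2 := qPochInf_ne_zero (norm_pow_lt_one hq (n := 2) (by norm_num)) h5
  have n3 := qPochInf_ne_zero (norm_pow_lt_one hq (n := 3) (by norm_num)) h5
  have n4 := qPochInf_ne_zero (norm_pow_lt_one hq (n := 4) (by norm_num)) h5
  have n5 := qPochInf_ne_zero h5 h5
  rw [e, qPochInf_eq_mul_pow_five hq] at h
  rw [eq_div_iff (mul_ne_zero n2 n3)]
  refine mul_left_cancel₀ (mul_ne_zero (mul_ne_zero n1 n4) n5) ?_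
  linear_combination h

end RogersSlater

/-! ### Reduction of S_0, S_1 to Rogers-Ramanujan series, and the recurrence in m -/

namespace RogersSlater

open Filter Topology PowerSeries

theorem sum_antidiagonal_assoc (F : ℕ → ℕ → ℕ → ℂ) (M : ℕ) :
    ∑ x ∈ Finset.HasAntidiagonal.antidiagonal M,
        ∑ y ∈ Finset.HasAntidiagonal.antidiagonal x.2, F x.1 y.1 y.2 =
      ∑ x ∈ Finset.HasAntidiagonal.antidiagonal M,
        ∑ y ∈ Finset.HasAntidiagonal.antidiagonal x.1, F y.1 y.2 x.2 := by
  simp only [Finset.sum_sigma']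
  apply Finset.sum_nbij' (fun ⟨⟨i, _j⟩, ⟨k, l⟩⟩ ↦ ⟨(i + k, l), (i, k)⟩)
    (fun ⟨⟨_i, j⟩, ⟨k, l⟩⟩ ↦ ⟨(k, l + j), (l, j)⟩) <;>
    rintro ⟨⟨i, j⟩, ⟨k, l⟩⟩ h <;>
    simp only [Finset.mem_sigma, Finset.HasAntidiagonal.mem_antidiagonal] at h ⊢ <;>
    obtain ⟨h1, h2⟩ := h <;> subst h2
  · exact ⟨by omega, trivial⟩
  · exact ⟨by omega, trivial⟩
  · rfl
  · rfl

/-- By Euler the series is 1/(X;q)_∞, whence the functional equation. -/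
theorem rescale_mk_one_div_qPoch {q : ℂ} (hq : ‖q‖ < 1) :
    rescale q (PowerSeries.mk fun n => 1 / qPoch q q n) =
      (1 - X) * PowerSeries.mk fun n => 1 / qPoch q q n := by
  ext n
  rw [sub_mul, one_mul, map_sub, coeff_rescale]
  cases n with
  | zero => simp
  | succ n =>
    rw [coeff_succ_X_mul]
    have h := one_sub_pow_mul_qRecip hq n
    rw [qRecip_natCast, qRecip_natCast] at h
    simp only [coeff_mk]
    linear_combination -h

/-- The evaluation of the Rogers-Szegő polynomial in base `q²` at `q`. -/
theorem sum_rogersSzego {q : ℂ} (hq : ‖q‖ < 1) (N : ℕ) :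
    ∑ x ∈ Finset.HasAntidiagonal.antidiagonal N,
      1 / qPoch (q ^ 2) (q ^ 2) x.1 * (q ^ x.2 * (1 / qPoch (q ^ 2) (q ^ 2) x.2)) =
      1 / qPoch q q N := by
  have hp := norm_pow_lt_one hq two_ne_zero
  set f : ℂ⟦X⟧ := PowerSeries.mk fun n => 1 / qPoch (q ^ 2) (q ^ 2) n with hf
  -- As f is 1/(X;q²)_∞, the product f(X) f(qX) is 1/(X;q)_∞; its functional equation determines the
  -- coefficients.
  have h : rescale q (f * rescale q f) = (1 - X) * (f * rescale q f) := by
    rw [map_mul, rescale_rescale, ← pow_two, hf, rescale_mk_one_div_qPoch hp]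
    ring
  have hc : ∀ N, ∑ x ∈ Finset.HasAntidiagonal.antidiagonal N,
      1 / qPoch (q ^ 2) (q ^ 2) x.1 * (q ^ x.2 * (1 / qPoch (q ^ 2) (q ^ 2) x.2)) =
      coeff N (f * rescale q f) := fun N => by
    simp [coeff_mul, hf, coeff_rescale]
  rw [hc]
  induction N with
  | zero => simp [← hc, qPoch_zero]
  | succ N ih =>
    have h1 := congrArg (coeff (N + 1)) h
    rw [sub_mul, one_mul, map_sub, coeff_rescale, coeff_succ_X_mul, ih] at h1
    have h2 := one_sub_pow_mul_qRecip hq N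
    rw [qRecip_natCast, qRecip_natCast] at h2
    refine mul_left_cancel₀ (one_sub_pow_succ_ne_zero hq N) ?_
    linear_combination -h1 - h2

/-- The finite `q`-binomial theorem. -/
theorem sum_qBinomial {p : ℂ} (hp : ‖p‖ < 1) (x : ℂ) (m : ℕ) :
    ∑ y ∈ Finset.HasAntidiagonal.antidiagonal m,
      p ^ (y.1.choose 2) * x ^ y.1 * (1 / qPoch p p y.1) * (1 / qPoch p p y.2) =
      qPoch (-x) p m * (1 / qPoch p p m) := by
  set f : ℂ⟦X⟧ := PowerSeries.mk fun n => 1 / qPoch p p n with hf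
  set g : ℂ⟦X⟧ := PowerSeries.mk fun n => p ^ (n.choose 2) * x ^ n * (1 / qPoch p p n) with hg
  -- Euler's other expansion: g is (-xX;p)_∞.
  have hg' : g = (1 + C x * X) * rescale p g := by
    ext n
    rw [add_mul, one_mul, map_add, mul_assoc, coeff_C_mul, coeff_rescale]
    cases n with
    | zero => simp
    | succ n =>
      rw [coeff_succ_X_mul, coeff_rescale]
      have h := one_sub_pow_mul_qRecip hp n
      rw [qRecip_natCast, qRecip_natCast] at h
      simp only [hg, coeff_mk, Nat.choose_succ_succ' n 1, Nat.choose_one_right, pow_add]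
      linear_combination p ^ n * p ^ (n.choose 2) * x ^ n * x * h
  have h : (1 + C x * X) * rescale p (g * f) = (1 - X) * (g * f) := by
    rw [map_mul, hf, rescale_mk_one_div_qPoch hp]
    conv_rhs => rw [hg']
    ring
  have hc : ∀ m, ∑ y ∈ Finset.HasAntidiagonal.antidiagonal m,
      p ^ (y.1.choose 2) * x ^ y.1 * (1 / qPoch p p y.1) * (1 / qPoch p p y.2) =
      coeff m (g * f) := fun m => by
    simp [coeff_mul, hf, hg]
  rw [hc]
  induction m with
  | zero => simp [← hc, qPoch_zero]
  | succ m ih =>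
    have h1 := congrArg (coeff (m + 1)) h
    rw [sub_mul, one_mul, map_sub, add_mul, one_mul, map_add, mul_assoc, coeff_C_mul,
      coeff_succ_X_mul, coeff_succ_X_mul, coeff_rescale, coeff_rescale, ih] at h1
    have h2 := one_sub_pow_mul_qRecip hp m
    rw [qRecip_natCast, qRecip_natCast] at h2
    refine mul_left_cancel₀ (one_sub_pow_succ_ne_zero hp m) ?_
    rw [qPoch_succ]
    linear_combination -h1 - qPoch (-x) p m * (1 + x * p ^ m) * h2

theorem qPoch_add (a q : ℂ) (n m : ℕ) :
    qPoch a q (n + m) = qPoch a q n * qPoch (a * q ^ n) q m := by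
  rw [qPoch, Finset.prod_range_add, qPoch, qPoch]
  simp only [pow_add, mul_assoc]

theorem qPoch_sq (p : ℂ) (n : ℕ) : qPoch (p ^ 2) (p ^ 2) n = qPoch p p n * qPoch (-p) p n := by
  rw [qPoch, qPoch, qPoch, ← Finset.prod_mul_distrib]
  refine Finset.prod_congr rfl fun k _ => ?_
  ring

/-- A finite form of the transformation of `∑ q^{n² + 2cn} / (q⁴; q⁴)_n` into a
Rogers-Ramanujan series. -/
theorem sum_antidiagonal_slater {q : ℂ} (hq : ‖q‖ < 1) {c : ℕ} (hc : c ≤ 1) (M : ℕ) :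
    ∑ x ∈ Finset.HasAntidiagonal.antidiagonal M,
        q ^ (x.1 ^ 2 + 2 * c * x.1) * (1 / qPoch (q ^ 4) (q ^ 4) x.1) *
          (qPoch (-q ^ 2) (q ^ 2) (x.1 + x.2) * (1 / qPoch (q ^ 2) (q ^ 2) x.2)) =
      ∑ x ∈ Finset.HasAntidiagonal.antidiagonal M,
        q ^ (x.1 ^ 2 + c * x.1) * (1 / qPoch q q x.1) * (1 / qPoch (q ^ 2) (q ^ 2) x.2) := by
  have hp := norm_pow_lt_one hq two_ne_zero
  set r : ℕ → ℂ := fun n => 1 / qPoch (q ^ 2) (q ^ 2) n with hr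
  -- Both sides are groupings of one triple sum: k + l first gives the q-binomial theorem, n + k
  -- first the Rogers-Szegő sum.
  have h := sum_antidiagonal_assoc
    (fun n k l => q ^ ((n + k) ^ 2 + k + 2 * c * n) * r n * r k * r l) M
  convert h using 1
  · refine Finset.sum_congr rfl fun x _ => ?_
    have hb := sum_qBinomial hp ((q ^ 2) ^ (x.1 + 1)) x.2
    have e4 : qPoch (q ^ 4) (q ^ 4) x.1 =
        qPoch (q ^ 2) (q ^ 2) x.1 * qPoch (-q ^ 2) (q ^ 2) x.1 := by
      rw [← qPoch_sq, ← pow_mul]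
    have e5 : -q ^ 2 * (q ^ 2) ^ x.1 = -(q ^ 2) ^ (x.1 + 1) := by ring
    have hne := qPoch_ne_zero (a := -q ^ 2) (by rwa [norm_neg]) hp x.1
    have hne' := qPoch_ne_zero hp hp x.1
    calc _ = q ^ (x.1 ^ 2 + 2 * c * x.1) * r x.1 *
          (qPoch (-(q ^ 2) ^ (x.1 + 1)) (q ^ 2) x.2 * r x.2) := by
          rw [e4, qPoch_add, e5]
          simp only [hr]
          field_simp
      _ = _ := by
          rw [← hb, Finset.mul_sum]
          refine Finset.sum_congr rfl fun y _ => ?_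
          have e : (x.1 + y.1) ^ 2 + y.1 + 2 * c * x.1 =
              x.1 ^ 2 + 2 * c * x.1 + (2 * y.1.choose 2 + 2 * ((x.1 + 1) * y.1)) := by
            have : 2 * y.1.choose 2 + y.1 = y.1 ^ 2 := by
              generalize y.1 = n
              induction n with
              | zero => rfl
              | succ n ih =>
                rw [Nat.choose_succ_succ' n 1, Nat.choose_one_right]
                linear_combination ih
            linear_combination -this
          rw [e]
          simp only [hr, pow_add, pow_mul]
          ring
  · refine Finset.sum_congr rfl fun x _ => ?_
    rw [← sum_rogersSzego hq, Finset.mul_sum, Finset.sum_mul]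
    -- With s = n + k the exponent is s² + k for c = 0 and s² + s + n for c = 1; in the latter n and
    -- k exchange roles, hence the swap.
    interval_cases c
    · refine Finset.sum_congr rfl fun y hy => ?_
      rw [← Finset.HasAntidiagonal.mem_antidiagonal.mp hy]
      simp only [hr]
      ring
    · rw [← Finset.Nat.sum_antidiagonal_swap]
      refine Finset.sum_congr rfl fun y hy => ?_
      rw [← Finset.HasAntidiagonal.mem_antidiagonal.mp hy]
      simp only [hr, Prod.fst_swap, Prod.snd_swap]
      ring

/-- Tannery's theorem, with the summand extended by zero for n > M. -/
theorem tendsto_sum_antidiagonal {a : ℕ → ℂ} {b : ℕ → ℕ → ℂ} {L : ℂ} {C : ℝ} (hC : 0 ≤ C)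
    (ha : Summable fun n => ‖a n‖) (hb : ∀ n m, ‖b n m‖ ≤ C)
    (hL : ∀ n, Tendsto (b n) atTop (𝓝 L)) :
    Tendsto (fun M => ∑ x ∈ Finset.HasAntidiagonal.antidiagonal M, a x.1 * b x.1 x.2) atTop
      (𝓝 ((∑' n, a n) * L)) := by
  rw [← tsum_mul_right]
  refine (tendsto_tsum_mul (C := C)
    (b := fun M n => if n ≤ M then b n (M - n) else 0) ha
    (fun M n => ?_) (fun n => ?_)).congr fun M => ?_
  · split_ifs
    · exact hb _ _
    · rwa [norm_zero]
  · refine ((hL n).comp (tendsto_sub_atTop_nat n)).congr' ?_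
    filter_upwards [eventually_ge_atTop n] with M hM
    rw [if_pos hM, Function.comp]
  · rw [Finset.Nat.sum_antidiagonal_eq_sum_range_succ_mk, tsum_eq_sum (s := Finset.range (M + 1))]
    · refine Finset.sum_congr rfl fun n hn => ?_
      rw [if_pos (by rw [Finset.mem_range] at hn; omega)]
    · intro n hn
      rw [if_neg (by rw [Finset.mem_range] at hn; omega), mul_zero]

theorem summable_slater {q : ℂ} (hq : ‖q‖ < 1) (m : ℕ) :
    Summable fun n => ‖q ^ (n ^ 2 + 2 * m * n) * (1 / qPoch (q ^ 4) (q ^ 4) n)‖ := by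
  obtain ⟨C, -, hC⟩ := exists_norm_le_of_tendsto
    (tendsto_one_div_qPoch (norm_pow_lt_one hq (n := 4) (by norm_num)))
  exact summable_norm_mul_of_pow_sq hq (2 * m) hC

theorem qPochInf_mul_tsum_slater {q : ℂ} (hq : ‖q‖ < 1) {c : ℕ} (hc : c ≤ 1) :
    qPochInf (-q ^ 2) (q ^ 2) *
        ∑' n, q ^ (n ^ 2 + 2 * c * n) * (1 / qPoch (q ^ 4) (q ^ 4) n) =
      ∑' n, q ^ (n ^ 2 + c * n) * (1 / qPoch q q n) := by
  have hp := norm_pow_lt_one hq two_ne_zero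
  have ht := tendsto_one_div_qPoch hp
  have ht' := tendsto_qPoch (-q ^ 2) hp
  obtain ⟨C, h0, hC⟩ := exists_norm_le_of_tendsto ht
  obtain ⟨D, hD0, hD⟩ := exists_norm_le_of_tendsto ht'
  obtain ⟨E, -, hE⟩ := exists_norm_le_of_tendsto (tendsto_one_div_qPoch hq)
  have h1 := tendsto_sum_antidiagonal
    (b := fun n m => qPoch (-q ^ 2) (q ^ 2) (n + m) * (1 / qPoch (q ^ 2) (q ^ 2) m))
    (mul_nonneg hD0 h0) (summable_slater hq c) (fun n m => norm_mul_le_of_le (hD _) (hC _))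
    (fun n => (ht'.comp (tendsto_atTop_mono (fun m => Nat.le_add_left m n) tendsto_id)).mul ht)
  have h2 := tendsto_sum_antidiagonal (b := fun _ m => 1 / qPoch (q ^ 2) (q ^ 2) m) h0
    (summable_norm_mul_of_pow_sq hq c hE) (fun _ => hC) (fun _ => ht)
  have h := tendsto_nhds_unique h1 (h2.congr fun M => (sum_antidiagonal_slater hq hc M).symm)
  have hne := qPochInf_ne_zero hp hp
  refine mul_right_cancel₀ (one_div_ne_zero hne) ?_
  rw [← h]
  ring

/-- The value of `∑ q^{n² + 2mn} / (q⁴; q⁴)_n`. -/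
noncomputable def slaterSum (m : ℕ) (q : ℂ) : ℂ :=
  ∑' n : ℕ, q ^ (n ^ 2 + 2 * m * n) * (1 / qPoch (q ^ 4) (q ^ 4) n)

theorem hasSum_slaterSum {q : ℂ} (hq : ‖q‖ < 1) (m : ℕ) :
    HasSum (fun n : ℕ => q ^ (n ^ 2 + 2 * m * n) / qPoch (q ^ 4) (q ^ 4) n) (slaterSum m q) := by
  simp only [div_eq_mul_one_div (q ^ _)]
  exact (summable_slater hq m).of_norm.hasSum

/-- In S_m - S_{m+2} each term gains 1 - q^{4n}, which kills n = 0 and cancels the last factor of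
(q⁴;q⁴)_n; then n is shifted by one. -/
theorem slaterSum_add_two {q : ℂ} (hq : ‖q‖ < 1) (m : ℕ) :
    slaterSum (m + 2) q = slaterSum m q - q ^ (2 * m + 1) * slaterSum (m + 1) q := by
  have h := (hasSum_slaterSum hq m).sub (hasSum_slaterSum hq (m + 2))
  have h' := (hasSum_nat_add_iff' 1).mpr h
  have h4 := norm_pow_lt_one hq (n := 4) (by norm_num)
  have key := h'.unique (hasSum_of_eq ((hasSum_slaterSum hq (m + 1)).mul_left (q ^ (2 * m + 1)))
    (fun n => ?_) rfl)
  · simp at key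
    linear_combination -key
  · rw [qPoch_succ]
    have h1 := qPoch_ne_zero h4 h4 n
    have h2 := one_sub_mul_pow_ne_zero h4 h4 n
    field_simp
    ring

theorem qPochInf_neg_sq_ne_zero {q : ℂ} (hq : ‖q‖ < 1) : qPochInf (-q ^ 2) (q ^ 2) ≠ 0 := by
  have hp := norm_pow_lt_one hq two_ne_zero
  exact qPochInf_ne_zero (by rwa [norm_neg]) hp

theorem slaterSum_zero {q : ℂ} (hq : ‖q‖ < 1) :
    slaterSum 0 q = 1 / (qPochInf q (q ^ 5) * qPochInf (q ^ 4) (q ^ 5) *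
      qPochInf (-q ^ 2) (q ^ 2)) := by
  have h := qPochInf_mul_tsum_slater hq (c := 0) (by norm_num)
  rw [rogersRamanujan_zero hq, ← slaterSum] at h
  rw [← div_div, ← h, mul_div_cancel_left₀ _ (qPochInf_neg_sq_ne_zero hq)]

theorem slaterSum_one {q : ℂ} (hq : ‖q‖ < 1) :
    slaterSum 1 q = 1 / (qPochInf (q ^ 2) (q ^ 5) * qPochInf (q ^ 3) (q ^ 5) *
      qPochInf (-q ^ 2) (q ^ 2)) := by
  have h := qPochInf_mul_tsum_slater hq (c := 1) le_rfl
  rw [rogersRamanujan_one hq, ← slaterSum] at h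
  rw [← div_div, ← h, mul_div_cancel_left₀ _ (qPochInf_neg_sq_ne_zero hq)]

theorem slaterSum_eq {q : ℂ} (hq : ‖q‖ < 1) (m : ℕ) :
    slaterSum m q = (-1) ^ m * (bPoly m q * slaterSum 0 q - aPoly m q * slaterSum 1 q) := by
  induction m using Nat.twoStepInduction with
  | zero => simp [aPoly, bPoly]
  | one => simp [aPoly_succ 0, slaterPoly_zero, bPoly_one]
  | more m ih1 ih2 =>
    rw [slaterSum_add_two hq, ih1, ih2, aPoly_add_two hq, bPoly_add_two_eq hq]
    ring

end RogersSlater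

theorem corollary2p6 (q : ℂ) (hq : ‖q‖ < 1) (m : ℕ) :
    HasSum (fun n : ℕ => q ^ (n ^ 2 + 2 * m * n) / RogersSlater.qPoch (q ^ 4) (q ^ 4) n)
      ((-1 : ℂ) ^ ((m : ℤ) - 1) *
        (RogersSlater.aPoly m q /
            (RogersSlater.qPochInf (q ^ 2) (q ^ 5) * RogersSlater.qPochInf (q ^ 3) (q ^ 5) *
              RogersSlater.qPochInf (-q ^ 2) (q ^ 2)) -
          RogersSlater.bPoly m q /
            (RogersSlater.qPochInf q (q ^ 5) * RogersSlater.qPochInf (q ^ 4) (q ^ 5) *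
              RogersSlater.qPochInf (-q ^ 2) (q ^ 2)))) := by
  have h : (-1 : ℂ) ^ ((m : ℤ) - 1) = -(-1) ^ m := by
    rw [zpow_sub_one₀ (by norm_num), zpow_natCast]
    norm_num
  convert RogersSlater.hasSum_slaterSum hq m using 1
  rw [RogersSlater.slaterSum_eq hq, RogersSlater.slaterSum_zero hq, RogersSlater.slaterSum_one hq, h]
  ring
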